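/- Let $f(x)\in\mathbb{Z}[x]$ be a polynomial of even degree $d\ge 4$ that is squarefree as a polynomial over $\mathbb{Q}$ (i.e. has no repeated roots in $\overline{\mathbb{Q}}$). Let $n\ge d+2$ be an even integer, and put $d_g=n/2$ and $d_h=(n-d)/2-1$. Let $a=(a_0,\dots,a_{d_g})$ and $b=(b_0,\dots,b_{d_h})$ be independent indeterminates over $\mathbb{Q}$, let $$g(x)=\sum_{i=0}^{d_g}a_ix^i,\qquad h(x)=\sum_{j=0}^{d_h}b_jx^j,$$ and let $$F_f(a,b,x)=g(x)^2-f(x)\,h(x)^2\in\mathbb{Q}(a,b)[x].$$ Then $F_f$ has degree $n$ in $x$, it is irreducible in $\mathbb{Q}(a,b)[x]$, and the Galois group over $\mathbb{Q}(a,b)$ of its splitting field is isomorphic to the symmetric group $S_n$. -/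

import Mathlib

open Polynomial

namespace HyperellipticFamily

noncomputable section

/-- The rational function field `ℚ(a, b)` in the independent indeterminates
`a = (a_0, …, a_dg)` and `b = (b_0, …, b_dh)`. -/
abbrev ParamField (dg dh : ℕ) : Type :=
  FractionRing (MvPolynomial (Fin (dg + 1) ⊕ Fin (dh + 1)) ℚ)

/-- The indeterminate `a_i`, as an element of `ℚ(a, b)`. -/
def a (dg dh : ℕ) (i : Fin (dg + 1)) : ParamField dg dh :=
  algebraMap (MvPolynomial (Fin (dg + 1) ⊕ Fin (dh + 1)) ℚ) (ParamField dg dh)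
    (MvPolynomial.X (Sum.inl i))

/-- The indeterminate `b_j`, as an element of `ℚ(a, b)`. -/
def b (dg dh : ℕ) (j : Fin (dh + 1)) : ParamField dg dh :=
  algebraMap (MvPolynomial (Fin (dg + 1) ⊕ Fin (dh + 1)) ℚ) (ParamField dg dh)
    (MvPolynomial.X (Sum.inr j))

/-- The generic polynomial `g(x) = ∑_{i = 0}^{dg} a_i x^i`. -/
def g (dg dh : ℕ) : (ParamField dg dh)[X] :=
  ∑ i : Fin (dg + 1), C (a dg dh i) * X ^ (i : ℕ)

/-- The generic polynomial `h(x) = ∑_{j = 0}^{dh} b_j x^j`. -/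
def h (dg dh : ℕ) : (ParamField dg dh)[X] :=
  ∑ j : Fin (dh + 1), C (b dg dh j) * X ^ (j : ℕ)

/-- The family `F_f(a, b, x) = g(x)^2 - f(x) h(x)^2`, a polynomial in `x` over `ℚ(a, b)`. -/
def family (f : ℤ[X]) (dg dh : ℕ) : (ParamField dg dh)[X] :=
  g dg dh ^ 2 - f.map (Int.castRingHom (ParamField dg dh)) * h dg dh ^ 2

end

end HyperellipticFamily

/-! Automorphisms of a separable specialisation lift to the generic Galois group, compatibly with a
bijection of the roots (`exists_bijOn_rootSet`), so it is enough to find specialisations that supply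
enough permutations. Sending h to 1 and g to a monic G of degree `dg` leaves G² - f. Suitable G give
transitivity, a point stabiliser transitive on the other roots, and a transposition. Transitivity on
distinct roots gives irreducibility, and a doubly transitive group with a transposition is
symmetric.

The first two cases take G = A(x^m + t) + T over ℂ(t), where A divides T² - f and is prime to T. The
cofactor H of A in G² - f is quadratic in t with discriminant 4f, which is not a square, so Gauss's
lemma makes H irreducible over ℂ(t) (`exists_irreducible_cofactor`). A = 1 gives transitivity and A
= x - p the stabiliser.

For the transposition, A = (x - p)² makes p the only multiple root of G² - f. Let k be an algebraic
closure of ℂ(t). Over k((s)), replacing G by G + s turns p into two conjugate irrational roots,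
while the others stay rational by Hensel's lemma (`exists_algEquiv_family_swap_of_sq_dvd`). -/

/-! ### Specialisation of Galois groups -/

/-- Two homomorphisms to a domain that agree on the invariants of a finite group are conjugate
under the group, on any finite family of elements (the coefficients of `p`). -/
theorem exists_smul_eq_of_comp_algebraMap_eq {A B Ω G : Type*} [CommRing A] [CommRing B]
    [Algebra A B] [CommRing Ω] [IsDomain Ω] [Group G] [Finite G] [MulSemiringAction G B]
    [Algebra.IsInvariant A B G] (Φ Ψ : B →+* Ω)
    (hΦΨ : Φ.comp (algebraMap A B) = Ψ.comp (algebraMap A B)) (p : B[X]) :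
    ∃ s : G, ∀ i, Ψ (p.coeff i) = Φ (s • p.coeff i) := by
  classical
  cases nonempty_fintype G
  -- The product of the Y - s • p has invariant coefficients, which come from `A`, where `Φ` and `Ψ`
  -- agree. Hence the image of p under `Ψ` is a root of the product of the Y - Φ(s • p), and one
  -- factor vanishes.
  have hc : (MulSemiringAction.charpoly G p).map (mapRingHom Φ) =
      (MulSemiringAction.charpoly G p).map (mapRingHom Ψ) := by
    ext n m
    simp only [coeff_map, coe_mapRingHom]
    obtain ⟨x, hx⟩ := Algebra.IsInvariant.isInvariant (A := A) (G := G)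
      (((MulSemiringAction.charpoly G p).coeff n).coeff m) (fun s ↦ by
        rw [← coeff_smul, MulSemiringAction.smul_coeff_charpoly])
    rw [← hx]
    exact congr($hΦΨ x)
  have h0 : ((MulSemiringAction.charpoly G p).map (mapRingHom Ψ)).eval (p.map Ψ) = 0 := by
    have := MulSemiringAction.eval_charpoly (G := G) p
    have := congrArg (mapRingHom Ψ) this
    rwa [← eval₂_at_apply, ← eval_map, map_zero] at this
  rw [← hc, MulSemiringAction.charpoly_eq, Polynomial.map_prod, eval_prod,
    Finset.prod_eq_zero_iff] at h0
  obtain ⟨s, -, hs⟩ := h0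
  refine ⟨s, fun i ↦ ?_⟩
  simp only [Polynomial.map_sub, map_X, map_C, eval_sub, eval_X, eval_C, sub_eq_zero] at hs
  simpa using congrArg (coeff · i) hs

theorem exists_smul_eq_on_finset {A B Ω G : Type*} [CommRing A] [CommRing B]
    [Algebra A B] [CommRing Ω] [IsDomain Ω] [Group G] [Finite G] [MulSemiringAction G B]
    [Algebra.IsInvariant A B G] (Φ Ψ : B →+* Ω)
    (hΦΨ : Φ.comp (algebraMap A B) = Ψ.comp (algebraMap A B)) (S : Finset B) :
    ∃ s : G, ∀ x ∈ S, Ψ x = Φ (s • x) := by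
  classical
  -- Packing `S` into the coefficients of one polynomial forces a single `s` for all its elements.
  obtain ⟨s, hs⟩ := exists_smul_eq_of_comp_algebraMap_eq (G := G) Φ Ψ hΦΨ
    (ofFn S.card fun i ↦ (S.equivFin.symm i : B))
  refine ⟨s, fun x hx ↦ ?_⟩
  have := hs (S.equivFin ⟨x, hx⟩)
  rwa [ofFn_coeff_eq_val_of_lt _ (Fin.is_lt _), Fin.eta, Equiv.symm_apply_apply] at this

/-- Lying over gives a prime `Q` above the kernel `P`; since `B ⧸ Q` is algebraic over `A ⧸ P`, the
embedding of `A ⧸ P` in `M` extends to it. -/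
theorem exists_ringHom_extending_of_isIntegral {A B M : Type*} [CommRing A] [CommRing B]
    [Algebra A B] [FaithfulSMul A B] [Algebra.IsIntegral A B] [Field M] [IsAlgClosed M]
    (φ : A →+* M) : ∃ Φ : B →+* M, Φ.comp (algebraMap A B) = φ := by
  obtain ⟨P, hP⟩ : ∃ P : Ideal A, P = RingHom.ker φ := ⟨_, rfl⟩
  have : P.IsPrime := hP ▸ RingHom.ker_isPrime φ
  obtain ⟨⟨Q, hQ, hQP⟩⟩ := Ideal.nonempty_primesOver (S := B) P
  have : IsDomain (B ⧸ Q) := Ideal.Quotient.isDomain Q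
  have : IsDomain (A ⧸ P) := Ideal.Quotient.isDomain P
  let ψ : A ⧸ P →+* M := Ideal.Quotient.lift P φ fun x hx ↦ by rwa [hP] at hx
  let _ : Algebra (A ⧸ P) M := ψ.toAlgebra
  have : FaithfulSMul (A ⧸ P) M := (faithfulSMul_iff_algebraMap_injective _ _).2
    (Ideal.injective_lift_iff _ |>.2 hP.symm)
  have : Module.IsTorsionFree (A ⧸ P) (B ⧸ Q) :=
    Module.isTorsionFree_iff_faithfulSMul.2 inferInstance
  have : Module.IsTorsionFree (A ⧸ P) M := Module.isTorsionFree_iff_faithfulSMul.2 inferInstance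
  have : Algebra.IsIntegral (A ⧸ P) (B ⧸ Q) := inferInstance
  let f : B ⧸ Q →ₐ[A ⧸ P] M := IsAlgClosed.lift
  refine ⟨f.toRingHom.comp (Ideal.Quotient.mk Q), RingHom.ext fun x ↦ ?_⟩
  exact f.commutes (Ideal.Quotient.mk _ x)

/-- The Galois group of a separable specialisation of a polynomial embeds, compatibly with a
bijection between the roots, in the Galois group of the polynomial. -/
theorem exists_bijOn_rootSet_of_monic {A K N M L : Type*} [CommRing A] [IsDomain A]
    [IsIntegrallyClosed A] [Field K] [Algebra A K] [IsFractionRing A K] [Field L] [Algebra K L]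
    [Field N] [Field M] [Algebra N M] [IsAlgClosed M] [IsGalois K L] [FiniteDimensional K L]
    (F : A[X]) (hF : F.Monic) (hs : ((F.map (algebraMap A K)).map (algebraMap K L)).Splits)
    (φ : A →+* N) (hsep : (F.map φ).Separable) :
    ∃ e : L → M, Set.BijOn e ((F.map (algebraMap A K)).rootSet L) ((F.map φ).rootSet M) ∧
      ∀ τ : M ≃ₐ[N] M, ∃ σ : L ≃ₐ[K] L, ∀ x ∈ (F.map (algebraMap A K)).rootSet L,
        e (σ x) = τ (e x) := by
  classical
  let _ : Algebra A L := ((algebraMap K L).comp (algebraMap A K)).toAlgebra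
  have : IsScalarTower A K L := .of_algebraMap_eq fun _ ↦ rfl
  suffices H : ∀ (B : Type _) [CommRing B] [Algebra A B] [Algebra B L] [IsScalarTower A B L]
      [IsIntegralClosure B A L], ∃ e : L → M,
      Set.BijOn e ((F.map (algebraMap A K)).rootSet L) ((F.map φ).rootSet M) ∧
      ∀ τ : M ≃ₐ[N] M, ∃ σ : L ≃ₐ[K] L, ∀ x ∈ (F.map (algebraMap A K)).rootSet L,
        e (σ x) = τ (e x) from H (integralClosure A L)
  intro B _ _ _ _ _
  have hBL : Function.Injective (algebraMap B L) := IsIntegralClosure.algebraMap_injective B A L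
  have : IsDomain B := hBL.isDomain
  have : IsFractionRing B L := IsIntegralClosure.isFractionRing_of_finite_extension A K L B
  have : Algebra.IsIntegral A B := IsIntegralClosure.isIntegral_algebra A L
  have hAL : Function.Injective (algebraMap A L) :=
    (algebraMap K L).injective.comp (IsFractionRing.injective A K)
  have : FaithfulSMul A B := (faithfulSMul_iff_algebraMap_injective _ _).2 fun x y hxy ↦ hAL (by
    rw [IsScalarTower.algebraMap_apply A B L, hxy, ← IsScalarTower.algebraMap_apply])
  obtain ⟨Φ, hΦ⟩ := exists_ringHom_extending_of_isIntegral (B := B) ((algebraMap N M).comp φ)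
  have hFB := hF.map (algebraMap A B)
  have hFL : (F.map (algebraMap A K)).map (algebraMap K L) =
      (F.map (algebraMap A B)).map (algebraMap B L) := by
    rw [map_map, map_map, ← IsScalarTower.algebraMap_eq, ← IsScalarTower.algebraMap_eq]
  have hsB : (F.map (algebraMap A B)).Splits := by
    rw [hFL] at hs
    refine hs.of_splits_map_of_injective hBL fun x hx ↦ ?_
    have hx := (mem_roots'.1 hx).2
    rw [IsRoot, ← hFL, eval_map, eval₂_map, ← IsScalarTower.algebraMap_eq] at hx
    exact IsIntegralClosure.isIntegral_iff.1 ⟨F, hF, hx⟩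
  have hrL : (F.map (algebraMap A K)).aroots L =
      (F.map (algebraMap A B)).roots.map (algebraMap B L) := by
    rw [aroots_def, hFL, hsB.roots_map_of_ne_zero (hFB.map _).ne_zero]
  have hrM : (F.map φ).aroots M = (F.map (algebraMap A B)).roots.map Φ := by
    rw [← hsB.roots_map_of_ne_zero (hFB.map _).ne_zero, aroots_def, map_map, map_map, hΦ]
  -- The roots of the monic `F` all lie in `B`, so the default value 0 is never used on them.
  let e : L → M := Function.extend (algebraMap B L) Φ 0
  have he (x : B) : e (algebraMap B L x) = Φ x := hBL.extend_apply _ _ _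
  have hrL' (x : L) : x ∈ (F.map (algebraMap A K)).rootSet L ↔
      ∃ b ∈ (F.map (algebraMap A B)).roots, algebraMap B L b = x := by
    simp [rootSet, hrL]
  refine ⟨e, ⟨?_, ?_, ?_⟩, fun τ ↦ ?_⟩
  · intro x hx
    obtain ⟨b, hb, rfl⟩ := (hrL' x).1 hx
    rw [he]
    simpa [rootSet, hrM] using ⟨b, by simpa using hb, rfl⟩
  · have hnd := nodup_aroots_iff_of_splits (F := N) (K := M) (f := F.map φ) (hF.map φ).ne_zero
      (IsAlgClosed.splits _) |>.2 hsep
    rw [hrM] at hnd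
    intro x hx y hy hxy
    obtain ⟨b, hb, rfl⟩ := (hrL' x).1 hx
    obtain ⟨c, hc, rfl⟩ := (hrL' y).1 hy
    rw [he, he] at hxy
    rw [Multiset.inj_on_of_nodup_map hnd b hb c hc hxy]
  · intro y hy
    obtain ⟨b, hb, rfl⟩ : ∃ b ∈ (F.map (algebraMap A B)).roots, Φ b = y := by
      simpa [rootSet, hrM] using hy
    exact ⟨algebraMap B L b, (hrL' _).2 ⟨b, hb, rfl⟩, he b⟩
  · let _ := IsIntegralClosure.MulSemiringAction A K L B
    have := Algebra.isInvariant_of_isGalois A K L B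
    -- `Φ` and `τ ∘ Φ` agree on `A` because `τ` fixes `N`.
    obtain ⟨σ, hσ⟩ := exists_smul_eq_on_finset (A := A) (G := L ≃ₐ[K] L) Φ
      ((τ : M →+* M).comp Φ) (by
        rw [RingHom.comp_assoc, hΦ]
        ext x
        simp) (F.map (algebraMap A B)).roots.toFinset
    refine ⟨σ, fun x hx ↦ ?_⟩
    obtain ⟨b, hb, rfl⟩ := (hrL' x).1 hx
    have h2 : algebraMap B L (σ • b) = σ (algebraMap B L b) :=
      algebraMap_galRestrict_apply A σ b
    rw [← h2, he, ← hσ b (Multiset.mem_toFinset.2 hb), he]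
    rfl

/-- The version of `exists_bijOn_rootSet_of_monic` for a polynomial that need not be monic. -/
theorem exists_bijOn_rootSet {A K N M L : Type*} [CommRing A] [IsDomain A]
    [IsIntegrallyClosed A] [Field K] [Algebra A K] [IsFractionRing A K] [Field L] [Algebra K L]
    [Field N] [Field M] [Algebra N M] [IsAlgClosed M] [IsGalois K L] [FiniteDimensional K L]
    (F : A[X]) (hs : ((F.map (algebraMap A K)).map (algebraMap K L)).Splits)
    (φ : A →+* N) (hφ : φ F.leadingCoeff ≠ 0) (hsep : (F.map φ).Separable) :
    ∃ e : L → M, Set.BijOn e ((F.map (algebraMap A K)).rootSet L) ((F.map φ).rootSet M) ∧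
      ∀ τ : M ≃ₐ[N] M, ∃ σ : L ≃ₐ[K] L, ∀ x ∈ (F.map (algebraMap A K)).rootSet L,
        e (σ x) = τ (e x) := by
  have hc : F.leadingCoeff ≠ 0 := fun h ↦ hφ (by rw [h, map_zero])
  obtain ⟨c, hcdef⟩ : ∃ c, c = F.leadingCoeff := ⟨_, rfl⟩
  rw [← hcdef] at hc hφ
  have hle : Submonoid.powers c ≤ nonZeroDivisors A :=
    Submonoid.powers_le.2 (mem_nonZeroDivisors_of_ne_zero hc)
  -- Inverting the leading coefficient keeps the ring integrally closed, lets `φ` extend, and allows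
  -- `F` to be made monic without changing its roots.
  let A' := Localization.Away c
  have : IsDomain A' := IsLocalization.isDomain_localization hle
  have : IsIntegrallyClosed A' := isIntegrallyClosed_of_isLocalization A' (Submonoid.powers c) hle
  let _ : Algebra A' K :=
    IsLocalization.localizationAlgebraOfSubmonoidLe A' K (Submonoid.powers c) _ hle
  have : IsScalarTower A A' K :=
    IsLocalization.localization_isScalarTower_of_submonoid_le A' K (Submonoid.powers c) _ hle
  have : IsFractionRing A' K := IsFractionRing.isFractionRing_of_isDomain_of_isLocalization
    (Submonoid.powers c) A' K
  let φ' : A' →+* N := IsLocalization.Away.lift c (g := φ) (IsUnit.mk0 _ hφ)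
  have hφ' (x : A) : φ' (algebraMap A A' x) = φ x := IsLocalization.Away.lift_eq ..
  let u : A' := IsLocalization.Away.invSelf c
  have hu : algebraMap A A' c * u = 1 := IsLocalization.Away.mul_invSelf c
  let F' : A'[X] := C u * F.map (algebraMap A A')
  have hF' : F'.Monic := monic_C_mul_of_mul_leadingCoeff_eq_one (by
    rw [leadingCoeff_map_of_injective (IsLocalization.injective A' hle), ← hcdef, mul_comm, hu])
  have hK : F'.map (algebraMap A' K) = C (algebraMap A' K u) * F.map (algebraMap A K) := by
    rw [Polynomial.map_mul, map_C, map_map, ← IsScalarTower.algebraMap_eq]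
  have hN : F'.map φ' = C (φ' u) * F.map φ := by
    rw [Polynomial.map_mul, map_C, map_map]
    congr 2
    exact RingHom.ext hφ'
  have huK : algebraMap A' K u ≠ 0 := by
    intro h
    have := congrArg (algebraMap A' K) hu
    rw [map_mul, h, mul_zero, map_one] at this
    exact zero_ne_one this
  have huN : φ' u ≠ 0 := by
    intro h
    have := congrArg φ' hu
    rw [map_mul, h, mul_zero, map_one] at this
    exact zero_ne_one this
  have hrK : (F'.map (algebraMap A' K)).rootSet L = (F.map (algebraMap A K)).rootSet L := by
    rw [hK, rootSet, rootSet, aroots_C_mul _ huK]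
  have hrN : (F'.map φ').rootSet M = (F.map φ).rootSet M := by
    rw [hN, rootSet, rootSet, aroots_C_mul _ huN]
  rw [← hrK, ← hrN]
  refine exists_bijOn_rootSet_of_monic F' hF' ?_ φ' ?_
  · rw [hK, Polynomial.map_mul, map_C]
    exact hs.C_mul _
  · rw [hN]
    exact hsep.unit_mul (isUnit_C.2 (IsUnit.mk0 _ huN))

/-! ### Irreducibility through the quadratic in the parameter -/

theorem IsIntegrallyClosed.isSquare_of_algebraMap_eq_sq {R K : Type*} [CommRing R] [IsDomain R]
    [IsIntegrallyClosed R] [Field K] [Algebra R K] [IsFractionRing R K] {f : R} {x : K}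
    (h : x ^ 2 = algebraMap R K f) : IsSquare f := by
  obtain ⟨y, rfl⟩ := IsIntegrallyClosed.exists_algebraMap_eq_of_isIntegral_pow (R := R)
    two_pos (x := x) (h ▸ isIntegral_algebraMap)
  exact ⟨y, IsFractionRing.injective R K (by rw [← h, ← pow_two, map_pow])⟩

/-- Coprimality makes the quadratic primitive, and a root x in the fraction field would give (Ax +
B)² = f. -/
theorem irreducible_quadratic_of_not_isSquare {R : Type*} [CommRing R] [IsDomain R]
    [NormalizedGCDMonoid R] (f A B D : R) (h2 : IsUnit (2 : R)) (hf : ¬ IsSquare f)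
    (hA : A ≠ 0) (hAD : A * D = B ^ 2 - f) (hcop : IsCoprime A B) :
    Irreducible (C A * X ^ 2 + C (2 * B) * X + C D) := by
  have hprim : (C A * X ^ 2 + C (2 * B) * X + C D).IsPrimitive := by
    intro r hr
    rw [C_dvd_iff_dvd_coeff] at hr
    have h1 := hr 1
    have h2' := hr 2
    simp [coeff_C] at h1 h2'
    exact hcop.isUnit_of_dvd' h2' ((h2.dvd_mul_left).1 h1)
  rw [hprim.irreducible_iff_irreducible_map_fraction_map (K := FractionRing R)]
  have hA' : algebraMap R (FractionRing R) A ≠ 0 := by simpa using hA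
  have hdeg : ((C A * X ^ 2 + C (2 * B) * X + C D).map
      (algebraMap R (FractionRing R))).natDegree = 2 := by
    simp only [Polynomial.map_add, Polynomial.map_mul, map_C, Polynomial.map_pow, map_X]
    exact natDegree_quadratic hA'
  rw [irreducible_iff_roots_eq_zero_of_degree_le_three hdeg.ge (by omega),
    Multiset.eq_zero_iff_forall_notMem]
  intro x hx
  have hx := (mem_roots'.1 hx).2
  apply hf
  have hAD' := congrArg (algebraMap R (FractionRing R)) hAD
  simp only [IsRoot, Polynomial.map_add, Polynomial.map_mul, map_C, Polynomial.map_pow, map_X,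
    eval_add, eval_mul, eval_C, eval_X, eval_pow, map_mul, map_sub, map_pow, map_ofNat,
    Polynomial.map_ofNat, eval_ofNat] at hx hAD'
  refine IsIntegrallyClosed.isSquare_of_algebraMap_eq_sq (K := FractionRing R)
    (x := algebraMap R _ A * x + algebraMap R _ B) ?_
  linear_combination (algebraMap R (FractionRing R) A) * hx - hAD'

/-- As a polynomial in t, `H` is At² + 2Bt + D, irreducible in k[x][t]. Exchanging the variables and
applying Gauss's lemma again gives irreducibility over k(t). -/
theorem irreducible_of_mul_eq_sq_sub {k N : Type*} [Field k] [CharZero k] [Field N]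
    [Algebra k[X] N] [IsFractionRing k[X] N] {f A B : k[X]} (hf : ¬ IsSquare f) (hA : A ≠ 0)
    (hdvd : A ∣ B ^ 2 - f) (hcop : IsCoprime A B) {H : N[X]} (hdeg : H.natDegree ≠ 0)
    (hH : A.map ((algebraMap k[X] N).comp C) * H =
      (A.map ((algebraMap k[X] N).comp C) * C (algebraMap k[X] N X) +
        B.map ((algebraMap k[X] N).comp C)) ^ 2 - f.map ((algebraMap k[X] N).comp C)) :
    Irreducible H := by
  classical
  obtain ⟨D, hD⟩ := hdvd
  have h2 : IsUnit (2 : k[X]) := by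
    rw [← map_ofNat (C : k →+* k[X])]
    exact isUnit_C.2 (IsUnit.mk0 _ two_ne_zero)
  have hirr := irreducible_quadratic_of_not_isSquare f A B D h2 hf hA hD.symm hcop
  rw [← MulEquiv.irreducible_iff (Bivariate.swap (R := k))] at hirr
  set P := Bivariate.swap (C A * X ^ 2 + C (2 * B) * X + C D) with hP
  have hPH : P.map (algebraMap k[X] N) = H := by
    have hA' : A.map ((algebraMap k[X] N).comp C) ≠ 0 := by
      rwa [Ne, Polynomial.map_eq_zero_iff]
      exact (IsFractionRing.injective k[X] N).comp C_injective
    apply mul_left_cancel₀ hA'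
    have hD' := congrArg (Polynomial.map ((algebraMap k[X] N).comp C)) hD
    rw [hH, hP]
    simp only [map_add, map_mul, map_pow, Bivariate.swap_C, Bivariate.swap_Y, Polynomial.map_add,
      Polynomial.map_mul, Polynomial.map_pow, Polynomial.map_map, map_C, Polynomial.map_sub,
      Polynomial.map_ofNat] at hD' ⊢
    linear_combination -hD'
  rw [← hPH] at hdeg ⊢
  rw [natDegree_map_eq_of_injective (IsFractionRing.injective k[X] N)] at hdeg
  exact (hirr.isPrimitive hdeg).irreducible_iff_irreducible_map_fraction_map.1 hirr

/-! ### Transpositions from a double root -/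

theorem Irreducible.exists_algEquiv_apply_eq {N M : Type*} [Field N] [Field M] [Algebra N M]
    [Normal N M] {q : N[X]} (hq : Irreducible q) {x y : M} (hx : aeval x q = 0)
    (hy : aeval y q = 0) : ∃ τ : M ≃ₐ[N] M, τ x = y := by
  have h : minpoly N x = minpoly N y := by
    rw [← minpoly.eq_of_irreducible hq hx, ← minpoly.eq_of_irreducible hq hy]
  obtain ⟨τ, hτ⟩ := isConjRoot_iff_exists_algEquiv.1 (show IsConjRoot N y x from h.symm)
  exact ⟨τ, hτ⟩

/-- If all but two of the roots of `P` are rational, then `P` is separable and an automorphism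
exchanges the other two. -/
theorem separable_and_exists_swap_of_card_roots_add_two {N M : Type*} [Field N] [CharZero N]
    [Field M] [Algebra N M] [IsAlgClosure N M] {P : N[X]} (hP0 : P ≠ 0) (S : Finset N)
    (hS : ∀ s ∈ S, P.IsRoot s) (hcard : S.card + 2 = P.natDegree) (hns : ¬ P.Splits) :
    P.Separable ∧ ∃ v ∈ P.rootSet M, ∃ w ∈ P.rootSet M, v ≠ w ∧ ∃ τ : M ≃ₐ[N] M,
      τ v = w ∧ τ w = v ∧ ∀ x ∈ P.rootSet M, x ≠ v → x ≠ w → τ x = x := by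
  classical
  have := IsAlgClosure.isAlgClosed N (K := M)
  have : Normal N M := IsAlgClosure.normal N M
  obtain ⟨q, hq⟩ : ∏ s ∈ S, (X - C s) ∣ P := by
    refine Finset.prod_dvd_of_coprime (fun s _ t _ hst ↦ ?_) fun s hs ↦ dvd_iff_isRoot.2 (hS s hs)
    exact isCoprime_X_sub_C_of_isUnit_sub (sub_ne_zero.2 hst).isUnit
  have hprod : (∏ s ∈ S, (X - C s)).Monic := monic_prod_of_monic _ _ fun s _ ↦ monic_X_sub_C s
  have hq0 : q ≠ 0 := by rintro rfl; simp at hq; exact hP0 hq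
  have hqd : q.natDegree = 2 := by
    have := congrArg natDegree hq
    rw [hprod.natDegree_mul' hq0, natDegree_prod_of_monic _ _ fun s _ ↦ monic_X_sub_C s] at this
    simp at this
    omega
  -- A rational root would split the quadratic `q`, and hence `P`.
  have hqr : ∀ x, ¬ q.IsRoot x := by
    intro x hx
    apply hns
    rw [hq]
    exact (Splits.prod fun s _ ↦ Splits.X_sub_C s).mul (Splits.of_natDegree_eq_two hqd hx)
  have hirr : Irreducible q := by
    rw [irreducible_iff_roots_eq_zero_of_degree_le_three hqd.ge (by omega),
      Multiset.eq_zero_iff_forall_notMem]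
    exact fun x hx ↦ hqr x (mem_roots'.1 hx).2
  have hsep : P.Separable := by
    rw [hq]
    refine (separable_prod_X_sub_C_iff'.2 fun _ _ _ _ h ↦ h).mul hirr.separable ?_
    refine (IsCoprime.prod_left fun s _ ↦ ?_)
    refine ((irreducible_X_sub_C s).coprime_iff_not_dvd).2 fun h ↦ hqr s (dvd_iff_isRoot.1 h)
  refine ⟨hsep, ?_⟩
  have hc : (q.rootSet M).ncard = 2 := by
    rw [Set.ncard_eq_toFinset_card', Set.toFinset_card,
      card_rootSet_eq_natDegree hirr.separable (IsAlgClosed.splits _), hqd]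
  obtain ⟨v, w, hvw, hrs⟩ := Set.ncard_eq_two.1 hc
  have hmem (x : M) : aeval x q = 0 ↔ x = v ∨ x = w := by
    rw [← Set.mem_singleton_iff (a := x) (b := w), ← Set.mem_insert_iff, ← hrs, mem_rootSet,
      and_iff_right hq0]
  have hv := (hmem v).2 (.inl rfl)
  have hw := (hmem w).2 (.inr rfl)
  obtain ⟨τ, hτ⟩ := hirr.exists_algEquiv_apply_eq hv hw
  refine ⟨v, ?_, w, ?_, hvw, τ, hτ, ?_, ?_⟩
  · rw [mem_rootSet, hq, map_mul, hv, mul_zero]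
    exact ⟨hq ▸ hP0, rfl⟩
  · rw [mem_rootSet, hq, map_mul, hw, mul_zero]
    exact ⟨hq ▸ hP0, rfl⟩
  · refine ((hmem (τ w)).1 ?_).resolve_right fun h ↦ hvw (τ.injective (hτ.trans h.symm))
    rw [aeval_algHom_apply, hw, map_zero]
  · intro x hx hxv hxw
    have hx := (mem_rootSet.1 hx).2
    rw [hq, map_mul, mul_eq_zero, hmem, or_iff_left (by tauto), map_prod,
      Finset.prod_eq_zero_iff] at hx
    obtain ⟨s, -, hs⟩ := hx
    simp [sub_eq_zero] at hs
    rw [hs, τ.commutes]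

theorem PowerSeries.exists_root_of_separable_root {k : Type*} [Field k] {P : (PowerSeries k)[X]}
    (hP : P.Monic) {r : k} (hr : (P.map (constantCoeff (R := k))).eval r = 0)
    (hr' : (P.map (constantCoeff (R := k))).derivative.eval r ≠ 0) :
    ∃ u : PowerSeries k, P.IsRoot u ∧ constantCoeff u = r := by
  have hev (Q : (PowerSeries k)[X]) (u : PowerSeries k) :
      (Q.map (constantCoeff (R := k))).eval (constantCoeff u) =
      constantCoeff (Q.eval u) := by rw [eval_map, eval₂_at_apply]
  obtain ⟨u, hu, hur⟩ := HenselianRing.is_henselian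
    (I := Ideal.span {(X : PowerSeries k)}) P hP (C r)
    (by
      rw [Ideal.mem_span_singleton, X_dvd_iff, ← hev, constantCoeff_C, hr])
    (by
      refine IsUnit.map _ (isUnit_iff_constantCoeff.2 (IsUnit.mk0 _ ?_))
      rwa [← hev, constantCoeff_C, ← derivative_map])
  refine ⟨u, hu, ?_⟩
  rwa [Ideal.mem_span_singleton, X_dvd_iff, map_sub, constantCoeff_C, sub_eq_zero] at hur

/-- The roots of `Q` lift by Hensel's lemma. A splitting over `N` would descend to the integrally
closed ring of power series, and one of the roots there would reduce to `p`. -/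
theorem PowerSeries.exists_finset_roots_and_not_splits {k N : Type*} [Field k] [Field N]
    [Algebra (PowerSeries k) N] [IsFractionRing (PowerSeries k) N]
    {P : (PowerSeries k)[X]} (hP : P.Monic) {p : k} {Q : k[X]}
    (hPQ : P.map (constantCoeff (R := k)) = (Polynomial.X - Polynomial.C p) ^ 2 * Q)
    (hQ : Q.Separable) (hQs : Q.Splits) (hQp : Q.eval p ≠ 0)
    (hp : ∀ u : PowerSeries k, constantCoeff u = p → P.eval u ≠ 0) :
    ¬ (P.map (algebraMap (PowerSeries k) N)).Splits ∧ ∃ S : Finset N,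
      (∀ s ∈ S, (P.map (algebraMap (PowerSeries k) N)).IsRoot s) ∧
      S.card + 2 = (P.map (algebraMap (PowerSeries k) N)).natDegree := by
  classical
  have hinj := IsFractionRing.injective (PowerSeries k) N
  constructor
  · intro hs
    have hsO : P.Splits := hs.of_splits_map_of_injective hinj fun x hx ↦ by
      have hx := (mem_roots'.1 hx).2
      exact IsIntegrallyClosed.isIntegral_iff.1 ⟨P, hP, by rwa [IsRoot, eval_map] at hx⟩
    have hpr : p ∈ (P.map (constantCoeff (R := k))).roots := by
      rw [mem_roots (hP.map _).ne_zero, hPQ]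
      simp
    rw [hsO.roots_map_of_ne_zero (hP.map _).ne_zero, Multiset.mem_map] at hpr
    obtain ⟨u, hu, hup⟩ := hpr
    exact hp u hup (mem_roots'.1 hu).2
  · have hroot (r : k) (hr : r ∈ Q.roots.toFinset) :
        ∃ u : PowerSeries k, P.IsRoot u ∧ constantCoeff u = r := by
      have hr := (mem_roots'.1 (Multiset.mem_toFinset.1 hr)).2
      refine exists_root_of_separable_root hP (by rw [hPQ, eval_mul, hr, mul_zero]) ?_
      rw [hPQ, derivative_mul, eval_add, eval_mul, hr, mul_zero, zero_add, eval_mul]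
      refine mul_ne_zero ?_ (hQ.eval₂_derivative_ne_zero (RingHom.id k) hr)
      simp only [eval_pow, eval_sub, eval_X, eval_C]
      refine pow_ne_zero _ (sub_ne_zero.2 ?_)
      rintro rfl
      exact hQp hr
    choose! u hu hur using hroot
    refine ⟨Q.roots.toFinset.image fun r ↦ algebraMap (PowerSeries k) N (u r), ?_, ?_⟩
    · intro s hs
      obtain ⟨r, hr, rfl⟩ := Finset.mem_image.1 hs
      exact (hu r hr).map
    · rw [Finset.card_image_of_injOn, Multiset.toFinset_card_of_nodup (nodup_roots hQ),
        ← hQs.natDegree_eq_card_roots, hP.natDegree_map, ← hP.natDegree_map (constantCoeff (R := k)), hPQ,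
        ((monic_X_sub_C p).pow 2).natDegree_mul' hQ.ne_zero, natDegree_pow, natDegree_X_sub_C]
      · ring
      · intro r hr s hs hrs
        rw [← hur r hr, ← hur s hs, hinj hrs]

/-- No root reduces to p: with s the power series variable, u = p + sw gives `P` the value s(2g(u) +
s(w²Q(u) + 1)), whose second factor has constant term 2g(p) ≠ 0. -/
theorem exists_finset_roots_sq_sub_of_sq_dvd {k N : Type*} [Field k] [CharZero k] [Field N]
    [Algebra (PowerSeries k) N] [IsFractionRing (PowerSeries k) N] {f g Q : k[X]} {p : k}
    (hg : g.Monic) (hfg : f.natDegree < 2 * g.natDegree) (hQ : Q.Separable) (hQs : Q.Splits)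
    (hQp : Q.eval p ≠ 0) (hgp : g.eval p ≠ 0) (h : g ^ 2 - f = (X - C p) ^ 2 * Q) {P : N[X]}
    (hP : P = (g.map ((algebraMap (PowerSeries k) N).comp PowerSeries.C) +
        C (algebraMap (PowerSeries k) N PowerSeries.X)) ^ 2 -
      f.map ((algebraMap (PowerSeries k) N).comp PowerSeries.C)) :
    ¬ P.Splits ∧ ∃ S : Finset N, (∀ s ∈ S, P.IsRoot s) ∧ S.card + 2 = P.natDegree := by
  obtain ⟨P', hP'⟩ : ∃ P', P' = (g.map PowerSeries.C + C PowerSeries.X) ^ 2 -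
    f.map PowerSeries.C := ⟨_, rfl⟩
  have hPP' : P = P'.map (algebraMap (PowerSeries k) N) := by
    rw [hP, hP']
    simp [Polynomial.map_map]
  have hg0 : 0 < g.natDegree := by omega
  have hdg : (g.map PowerSeries.C + C (PowerSeries.X : PowerSeries k)).natDegree = g.natDegree := by
    rw [natDegree_add_C, hg.natDegree_map]
  have hmg : (g.map PowerSeries.C + C (PowerSeries.X : PowerSeries k)).Monic :=
    (hg.map _).add_of_left (degree_C_le.trans_lt (by
      rw [hg.degree_map]
      exact natDegree_pos_iff_degree_pos.1 hg0))
  have hmon : P'.Monic := by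
    rw [hP']
    refine (hmg.pow 2).sub_of_left (degree_lt_degree ?_)
    rw [hmg.natDegree_pow, hdg]
    exact natDegree_map_le.trans_lt hfg
  rw [hPP']
  refine PowerSeries.exists_finset_roots_and_not_splits hmon (p := p) (Q := Q) ?_ hQ hQs hQp ?_
  · have hcC : (PowerSeries.constantCoeff (R := k)).comp PowerSeries.C = RingHom.id k := by
      ext; simp
    rw [← h, hP']
    simp [Polynomial.map_map, hcC]
  · intro u hu h0
    obtain ⟨w, hw⟩ : PowerSeries.X ∣ u - PowerSeries.C p := by
      rw [PowerSeries.X_dvd_iff, map_sub, hu, PowerSeries.constantCoeff_C, sub_self]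
    have hQ' := congrArg (fun q ↦ (q.map PowerSeries.C).eval u) h
    simp only [Polynomial.map_sub, Polynomial.map_pow, Polynomial.map_mul, map_X, map_C, eval_sub,
      eval_pow, eval_mul, eval_X, eval_C, hw] at hQ'
    rw [hP'] at h0
    simp only [eval_sub, eval_pow, eval_add, eval_C] at h0
    have h1 : PowerSeries.X * (PowerSeries.X * (w ^ 2 * (Q.map PowerSeries.C).eval u + 1) +
        2 * (g.map PowerSeries.C).eval u) = 0 := by
      linear_combination h0 - hQ'
    have h2 := congrArg (PowerSeries.constantCoeff (R := k))
      ((mul_eq_zero.1 h1).resolve_left PowerSeries.X_ne_zero)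
    have hev : PowerSeries.constantCoeff ((g.map PowerSeries.C).eval u) = g.eval p := by
      rw [eval_map, hom_eval₂, hu]
      convert eval₂_id
      ext; simp
    have h3 : PowerSeries.constantCoeff 2 = (2 : k) := map_ofNat _ 2
    simp [hev, hgp, h3] at h2

/-! ### From permutations of the roots to irreducibility and the symmetric group -/

/-- The minimal polynomial of one root divides `F` and, by transitivity, vanishes at all the roots,
so the degrees agree. -/
theorem irreducible_of_forall_exists_algEquiv {K L : Type*} [Field K] [Field L] [Algebra K L]
    {F : K[X]} (hF : F.natDegree ≠ 0) (hcard : (F.rootSet L).ncard = F.natDegree)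
    (htrans : ∀ x ∈ F.rootSet L, ∀ y ∈ F.rootSet L, ∃ σ : L ≃ₐ[K] L, σ x = y) :
    Irreducible F := by
  have hF0 : F ≠ 0 := by rintro rfl; simp at hF
  obtain ⟨x, hx⟩ := Set.nonempty_of_ncard_ne_zero (hcard.trans_ne hF)
  have hint : IsIntegral K x := isAlgebraic_iff_isIntegral.1 ⟨F, hF0, (mem_rootSet.1 hx).2⟩
  have hdvd : minpoly K x ∣ F := minpoly.dvd K x (mem_rootSet.1 hx).2
  have hsub : F.rootSet L ⊆ (minpoly K x).rootSet L := by
    intro y hy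
    obtain ⟨σ, rfl⟩ := htrans x hx y hy
    rw [mem_rootSet, aeval_algHom_apply, minpoly.aeval, map_zero]
    exact ⟨minpoly.ne_zero hint, rfl⟩
  have hle : F.natDegree ≤ (minpoly K x).natDegree := by
    rw [← hcard]
    exact (Set.ncard_le_ncard hsub (rootSet_finite _ _)).trans (ncard_rootSet_le _ _)
  exact (associated_of_dvd_of_natDegree_le hdvd hF0 hle).irreducible (minpoly.irreducible hint)

/-- A doubly transitive Galois group that contains a transposition is the symmetric group. -/
theorem Polynomial.Gal.nonempty_mulEquiv_perm {K : Type*} [Field K] {F : K[X]} {n : ℕ}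
    (hn : (F.rootSet F.SplittingField).ncard = n)
    (htrans : ∀ x ∈ F.rootSet F.SplittingField, ∀ y ∈ F.rootSet F.SplittingField,
      ∃ σ : F.SplittingField ≃ₐ[K] F.SplittingField, σ x = y)
    (hstab : ∃ x₀ ∈ F.rootSet F.SplittingField, ∀ x ∈ F.rootSet F.SplittingField,
      ∀ y ∈ F.rootSet F.SplittingField, x ≠ x₀ → y ≠ x₀ →
      ∃ σ : F.SplittingField ≃ₐ[K] F.SplittingField, σ x₀ = x₀ ∧ σ x = y)
    (hswap : ∃ v ∈ F.rootSet F.SplittingField, ∃ w ∈ F.rootSet F.SplittingField, v ≠ w ∧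
      ∃ σ : F.SplittingField ≃ₐ[K] F.SplittingField, σ v = w ∧ σ w = v ∧
        ∀ x ∈ F.rootSet F.SplittingField, x ≠ v → x ≠ w → σ x = x) :
    Nonempty (F.Gal ≃* Equiv.Perm (Fin n)) := by
  classical
  let R := F.rootSet F.SplittingField
  let ρ : F.Gal →* Equiv.Perm R :=
    MulAction.toPermHom (F.SplittingField ≃ₐ[K] F.SplittingField) R
  have hρ (σ : F.SplittingField ≃ₐ[K] F.SplittingField) (x : R) :
      (ρ σ x : F.SplittingField) = σ x :=
    rfl
  have hinj : Function.Injective ρ := fun σ τ h ↦ Gal.ext F fun x hx ↦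
    congrArg Subtype.val (DFunLike.congr_fun h (⟨x, hx⟩ : R))
  -- Double transitivity: move both first points to `x₀`, then match the second points inside its
  -- stabiliser.
  have h2 (v w x y : R) (hvw : v ≠ w) (hxy : x ≠ y) : ∃ π ∈ ρ.range, π v = x ∧ π w = y := by
    obtain ⟨x₀, hx₀, h⟩ := hstab
    obtain ⟨σ, hσ⟩ := htrans v v.2 x₀ hx₀
    obtain ⟨τ, hτ⟩ := htrans x x.2 x₀ hx₀
    obtain ⟨ν, hν, hν'⟩ := h (ρ σ w) (ρ σ w).2 (ρ τ y) (ρ τ y).2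
      (fun h ↦ hvw (Subtype.ext (σ.injective (hσ.trans h.symm))))
      (fun h ↦ hxy (Subtype.ext (τ.injective (hτ.trans h.symm))))
    refine ⟨(ρ τ)⁻¹ * ρ ν * ρ σ, mul_mem (mul_mem (inv_mem ⟨τ, rfl⟩) ⟨ν, rfl⟩) ⟨σ, rfl⟩, ?_, ?_⟩
    · rw [mul_assoc, Equiv.Perm.mul_apply, Equiv.Perm.inv_eq_iff_eq]
      exact Subtype.ext (by rw [Equiv.Perm.mul_apply, hρ, hρ, hρ, hσ, hν, hτ])
    · rw [mul_assoc, Equiv.Perm.mul_apply, Equiv.Perm.inv_eq_iff_eq]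
      exact Subtype.ext hν'
  obtain ⟨v, hv, w, hw, hvw, σ, hσv, hσw, hσ⟩ := hswap
  have hs : Equiv.swap (⟨v, hv⟩ : R) ⟨w, hw⟩ ∈ ρ.range := by
    refine ⟨σ, Equiv.ext fun x ↦ Subtype.ext ?_⟩
    rw [hρ]
    rcases eq_or_ne x ⟨v, hv⟩ with rfl | hxv
    · rw [Equiv.swap_apply_left, hσv]
    rcases eq_or_ne x ⟨w, hw⟩ with rfl | hxw
    · rw [Equiv.swap_apply_right, hσw]
    rw [Equiv.swap_apply_of_ne_of_ne hxv hxw,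
      hσ x x.2 (fun h ↦ hxv (Subtype.ext h)) (fun h ↦ hxw (Subtype.ext h))]
  have : Finite R := rootSet_finite F _
  have hsurj : Function.Surjective ρ := by
    rw [← MonoidHom.range_eq_top, eq_top_iff, ← Equiv.Perm.closure_isSwap, Subgroup.closure_le]
    rintro _ ⟨x, y, hxy, rfl⟩
    -- By double transitivity every transposition is a conjugate of the given one.
    obtain ⟨π, hπ, rfl, rfl⟩ := h2 ⟨v, hv⟩ ⟨w, hw⟩ x y (fun h ↦ hvw (congrArg Subtype.val h)) hxy
    rw [Equiv.swap_apply_apply]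
    exact mul_mem (mul_mem hπ hs) (inv_mem hπ)
  have e : R ≃ Fin n := Finite.equivFinOfCardEq hn
  exact ⟨(MulEquiv.ofBijective ρ ⟨hinj, hsurj⟩).trans e.permCongrHom⟩

/-! ### The pencil over k(t) -/

/-- The members `g = A (x^m + t) + T` of a pencil for which `A` divides `g ^ 2 - f`. -/
theorem exists_irreducible_cofactor {k N : Type*} [Field k] [CharZero k] [Field N]
    [Algebra k[X] N] [IsFractionRing k[X] N] {f A T : k[X]} {m : ℕ} (hf : ¬ IsSquare f)
    (hA : A.Monic) (hm : m ≠ 0) (hT : T.natDegree < A.natDegree + m)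
    (hfd : f.natDegree < 2 * (A.natDegree + m)) (hdvd : A ∣ T ^ 2 - f) (hcop : IsCoprime A T) :
    ∃ g H : N[X], g.Monic ∧ g.natDegree = A.natDegree + m ∧ Irreducible H ∧
      H.natDegree + A.natDegree = 2 * (A.natDegree + m) ∧
      g ^ 2 - f.map ((algebraMap k[X] N).comp C) = A.map ((algebraMap k[X] N).comp C) * H := by
  set ι := (algebraMap k[X] N).comp C with hι
  obtain ⟨D, hD⟩ := hdvd
  set t : N := algebraMap k[X] N X with ht
  have hA' := hA.map ι
  have hu : (X ^ m + C t : N[X]).Monic := monic_X_pow_add_C t hm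
  have hAu := hA'.mul hu
  have hAud : (A.map ι * (X ^ m + C t)).natDegree = A.natDegree + m := by
    rw [hA'.natDegree_mul hu, hA.natDegree_map, natDegree_X_pow_add_C]
  have hlt : (T.map ι).degree < (A.map ι * (X ^ m + C t)).degree :=
    degree_lt_degree (hAud ▸ natDegree_map_le.trans_lt hT)
  have hg : (A.map ι * (X ^ m + C t) + T.map ι).Monic := hAu.add_of_left hlt
  have hgd : (A.map ι * (X ^ m + C t) + T.map ι).natDegree = A.natDegree + m := by
    rw [natDegree_add_eq_left_of_degree_lt hlt, hAud]
  set g := A.map ι * (X ^ m + C t) + T.map ι with hgdef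
  set H : N[X] := A.map ι * (X ^ m + C t) ^ 2 + 2 * (X ^ m + C t) * T.map ι + D.map ι with hH
  have hgH : g ^ 2 - f.map ι = A.map ι * H := by
    have hD' := congrArg (Polynomial.map ι) hD
    simp only [Polynomial.map_sub, Polynomial.map_pow, Polynomial.map_mul] at hD'
    rw [hgdef, hH]
    linear_combination hD'
  have hdeg : (g ^ 2 - f.map ι).natDegree = 2 * (A.natDegree + m) := by
    rw [natDegree_sub_eq_left_of_natDegree_lt, hg.natDegree_pow, hgd]
    rw [hg.natDegree_pow, hgd]
    exact natDegree_map_le.trans_lt hfd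
  have hH0 : H ≠ 0 := by
    rintro h
    rw [hgH, h, mul_zero, natDegree_zero] at hdeg
    omega
  have hHd : H.natDegree + A.natDegree = 2 * (A.natDegree + m) := by
    rw [← hdeg, hgH, hA'.natDegree_mul' hH0, hA.natDegree_map, add_comm]
  refine ⟨g, H, hg, hgd, ?_, hHd, hgH⟩
  -- This `B` makes g = At + B; it is congruent to `T` modulo `A`, so divisibility and coprimality
  -- carry over.
  refine irreducible_of_mul_eq_sq_sub hf hA.ne_zero (B := A * X ^ m + T) ?_ ?_ (by omega) ?_
  · exact ⟨D + A * X ^ (2 * m) + 2 * X ^ m * T, by linear_combination hD⟩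
  · exact IsCoprime.mul_add_left_right hcop (X ^ m)
  · rw [← hι, ← hgH, hgdef]
    simp only [Polynomial.map_add, Polynomial.map_mul, Polynomial.map_pow, map_X]
    ring

/-! ### Specialising the family to G² - f -/

namespace HyperellipticFamily

/-- The polynomial `g^2 - f h^2` over the polynomial ring `ℚ[a, b]`. -/
noncomputable def integralFamily (f : ℤ[X]) (dg dh : ℕ) :
    (MvPolynomial (Fin (dg + 1) ⊕ Fin (dh + 1)) ℚ)[X] :=
  (∑ i : Fin (dg + 1), C (MvPolynomial.X (Sum.inl i)) * X ^ (i : ℕ)) ^ 2 -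
    f.map (Int.castRingHom _) *
      (∑ j : Fin (dh + 1), C (MvPolynomial.X (Sum.inr j)) * X ^ (j : ℕ)) ^ 2

theorem map_integralFamily (f : ℤ[X]) (dg dh : ℕ) :
    (integralFamily f dg dh).map (algebraMap _ (ParamField dg dh)) = family f dg dh := by
  simp [integralFamily, family, g, h, a, b, Polynomial.map_sum, Polynomial.map_map,
    RingHom.ext_int _ (Int.castRingHom (ParamField dg dh))]

theorem natDegree_sum_C_mul_X_pow_le {R : Type*} [Semiring R] {m : ℕ} (c : Fin (m + 1) → R) :
    (∑ i : Fin (m + 1), C (c i) * X ^ (i : ℕ)).natDegree ≤ m :=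
  natDegree_sum_le_of_forall_le _ _ fun i _ ↦ (natDegree_C_mul_X_pow_le _ _).trans (by omega)

theorem coeff_sum_C_mul_X_pow_last {R : Type*} [Semiring R] {m : ℕ} (c : Fin (m + 1) → R) :
    (∑ i : Fin (m + 1), C (c i) * X ^ (i : ℕ)).coeff m = c (Fin.last m) := by
  rw [finsetSum_coeff, Finset.sum_eq_single (Fin.last m)]
  · simp
  · intro i _ hi
    rw [coeff_C_mul_X_pow, if_neg]
    exact fun h ↦ hi (Fin.ext h.symm)
  · simp

/-- The term f h² has degree below 2 `dg`, so the leading term comes from g² alone. -/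
theorem natDegree_integralFamily_and_leadingCoeff {f : ℤ[X]} {dg dh : ℕ}
    (hd : f.natDegree + 2 * dh < 2 * dg) :
    (integralFamily f dg dh).natDegree = 2 * dg ∧
      (integralFamily f dg dh).leadingCoeff = MvPolynomial.X (Sum.inl (Fin.last dg)) ^ 2 := by
  have h1 : (f.map (Int.castRingHom (MvPolynomial (Fin (dg + 1) ⊕ Fin (dh + 1)) ℚ)) *
      (∑ j : Fin (dh + 1), C (MvPolynomial.X (Sum.inr j)) * X ^ (j : ℕ)) ^ 2).natDegree <
      2 * dg := by
    refine (natDegree_mul_le_of_le natDegree_map_le (natDegree_pow_le_of_le 2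
      (natDegree_sum_C_mul_X_pow_le _))).trans_lt hd
  have h2 : (integralFamily f dg dh).coeff (2 * dg) =
      MvPolynomial.X (Sum.inl (Fin.last dg)) ^ 2 := by
    rw [integralFamily, coeff_sub, coeff_eq_zero_of_natDegree_lt h1, sub_zero,
      coeff_pow_of_natDegree_le (natDegree_sum_C_mul_X_pow_le _), coeff_sum_C_mul_X_pow_last]
  have h3 : (integralFamily f dg dh).natDegree = 2 * dg := by
    refine natDegree_eq_of_le_of_coeff_ne_zero ?_ (by
      rw [h2]; exact pow_ne_zero _ (MvPolynomial.X_ne_zero _))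
    refine (natDegree_sub_le_of_le (natDegree_pow_le_of_le 2 (natDegree_sum_C_mul_X_pow_le _))
      h1.le).trans ?_
    rw [mul_comm, max_self]
  exact ⟨h3, by rw [leadingCoeff, h3, h2]⟩

theorem exists_map_integralFamily_eq {N : Type*} [Field N] [CharZero N] (f : ℤ[X]) {dg : ℕ}
    (dh : ℕ) {G : N[X]} (hG : G.Monic) (hGd : G.natDegree = dg) :
    ∃ φ : MvPolynomial (Fin (dg + 1) ⊕ Fin (dh + 1)) ℚ →+* N,
      φ (MvPolynomial.X (Sum.inl (Fin.last dg))) = 1 ∧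
      (integralFamily f dg dh).map φ = G ^ 2 - f.map (Int.castRingHom N) := by
  -- g becomes `G`, and h becomes the constant 1.
  refine ⟨MvPolynomial.eval₂Hom (algebraMap ℚ N)
    (Sum.elim (fun i ↦ G.coeff i) (fun j ↦ if j = 0 then 1 else 0)), ?_, ?_⟩
  · simp [← hGd, hG]
  · have h1 : ∑ i : Fin (dg + 1), C (G.coeff i) * X ^ (i : ℕ) = G := by
      rw [Fin.sum_univ_eq_sum_range (fun i ↦ C (G.coeff i) * X ^ i), ← hGd,
        ← G.as_sum_range_C_mul_X_pow]
    simp only [integralFamily, Polynomial.map_sub, Polynomial.map_mul, Polynomial.map_pow,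
      Polynomial.map_sum, Polynomial.map_map, map_C, map_X, MvPolynomial.coe_eval₂Hom,
      MvPolynomial.eval₂_X, Sum.elim_inl, Sum.elim_inr, h1]
    rw [RingHom.ext_int (RingHom.comp _ _) (Int.castRingHom N), Finset.sum_eq_single 0] <;>
      simp +contextual

theorem exists_bijOn_rootSet_family {N M : Type*} [Field N] [CharZero N] [Field M] [Algebra N M]
    [IsAlgClosed M] {f : ℤ[X]} {dg dh : ℕ} (hd : f.natDegree + 2 * dh < 2 * dg) {G P : N[X]}
    (hG : G.Monic) (hGd : G.natDegree = dg) (hP : P = G ^ 2 - f.map (Int.castRingHom N))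
    (hsep : P.Separable) :
    ∃ e : (family f dg dh).SplittingField → M,
      Set.BijOn e ((family f dg dh).rootSet (family f dg dh).SplittingField) (P.rootSet M) ∧
      ∀ τ : M ≃ₐ[N] M,
        ∃ σ : (family f dg dh).SplittingField ≃ₐ[ParamField dg dh] (family f dg dh).SplittingField,
          ∀ x ∈ (family f dg dh).rootSet (family f dg dh).SplittingField, e (σ x) = τ (e x) := by
  obtain ⟨φ, hφ, hφP⟩ := exists_map_integralFamily_eq f dh hG hGd
  rw [← hP] at hφP
  have hmap := map_integralFamily f dg dh
  have : IsGalois (ParamField dg dh) (family f dg dh).SplittingField := {}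
  have key := exists_bijOn_rootSet (K := ParamField dg dh) (L := (family f dg dh).SplittingField)
    (M := M) (integralFamily f dg dh) (by rw [hmap]; exact SplittingField.splits _) φ
    (by rw [(natDegree_integralFamily_and_leadingCoeff hd).2, map_pow, hφ, one_pow]
        exact one_ne_zero) (by rwa [hφP])
  rwa [hmap, hφP] at key

theorem natDegree_family {f : ℤ[X]} {dg dh : ℕ} (hd : f.natDegree + 2 * dh < 2 * dg) :
    (family f dg dh).natDegree = 2 * dg := by
  rw [← map_integralFamily, natDegree_map_eq_of_injective (IsFractionRing.injective _ _),
    (natDegree_integralFamily_and_leadingCoeff hd).1]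

end HyperellipticFamily

theorem Polynomial.Separable.not_isSquare {k : Type*} [Field k] {f : k[X]} (hf : f.Separable)
    (hd : f.natDegree ≠ 0) : ¬ IsSquare f := by
  rintro ⟨r, rfl⟩
  have hr := hf.squarefree r dvd_rfl
  exact hd (natDegree_eq_zero_of_isUnit (hr.mul hr))

theorem Polynomial.isCoprime_C_right {k : Type*} [Field k] {q : k[X]} {y : k} (hy : y ≠ 0) :
    IsCoprime q (C y) :=
  ⟨0, C y⁻¹, by rw [zero_mul, zero_add, ← C_mul, inv_mul_cancel₀ hy, C_1]⟩

theorem Irreducible.separable_X_sub_C_mul {k : Type*} [Field k] [CharZero k] {H : k[X]} {p : k}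
    (hH : Irreducible H) (hp : ¬ H.IsRoot p) : ((X - C p) * H).Separable :=
  separable_X_sub_C.mul hH.separable
    ((irreducible_X_sub_C p).coprime_iff_not_dvd.2 fun h ↦ hp (dvd_iff_isRoot.1 h))

theorem Polynomial.apply_mem_rootSet {K L : Type*} [Field K] [Field L] [Algebra K L] {F : K[X]}
    (σ : L ≃ₐ[K] L) {x : L} (hx : x ∈ F.rootSet L) : σ x ∈ F.rootSet L := by
  rw [mem_rootSet] at hx ⊢
  exact ⟨hx.1, by rw [aeval_algHom_apply, hx.2, map_zero]⟩

theorem Polynomial.X_sub_C_sq_dvd {k : Type*} [Field k] {q : k[X]} {p : k} (h : q.eval p = 0)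
    (h' : q.derivative.eval p = 0) : (X - C p) ^ 2 ∣ q := by
  obtain ⟨s, rfl⟩ := dvd_iff_isRoot.2 h
  rw [pow_two]
  refine mul_dvd_mul_left _ (dvd_iff_isRoot.2 ?_)
  simpa [derivative_mul] using h'

/-! ### The specialisations that produce the permutations -/

namespace HyperellipticFamily

section

variable {f : ℤ[X]} {dg dh : ℕ}

theorem charZero_fractionRing_polynomial : CharZero (FractionRing ℂ[X]) :=
  charZero_of_injective_algebraMap (IsFractionRing.injective ℂ[X] (FractionRing ℂ[X]))

theorem exists_root_data (hf : (f.map (Int.castRingHom ℂ)).Separable) :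
    ∃ p y : ℂ, y ≠ 0 ∧ y ^ 2 = (f.map (Int.castRingHom ℂ)).eval p := by
  have hf0 : f.map (Int.castRingHom ℂ) ≠ 0 := hf.ne_zero
  obtain ⟨p, hp⟩ : ∃ p, (f.map (Int.castRingHom ℂ)).eval p ≠ 0 := by
    by_contra! h
    exact hf0 (Polynomial.funext fun x ↦ by simpa using h x)
  obtain ⟨y, hy⟩ := IsAlgClosed.exists_pow_nat_eq ((f.map (Int.castRingHom ℂ)).eval p) two_pos
  exact ⟨p, y, by rintro rfl; exact hp (by simpa using hy.symm), hy⟩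

theorem exists_algEquiv_family_apply_eq (hf : (f.map (Int.castRingHom ℂ)).Separable)
    (hf0 : f.natDegree ≠ 0) (hd : f.natDegree + 2 * dh < 2 * dg) :
    ((family f dg dh).rootSet (family f dg dh).SplittingField).ncard = 2 * dg ∧
    ∀ x ∈ (family f dg dh).rootSet (family f dg dh).SplittingField,
    ∀ y ∈ (family f dg dh).rootSet (family f dg dh).SplittingField,
      ∃ σ : (family f dg dh).SplittingField ≃ₐ[ParamField dg dh] (family f dg dh).SplittingField,
        σ x = y := by
  have := charZero_fractionRing_polynomial
  have hfd : (f.map (Int.castRingHom ℂ)).natDegree = f.natDegree :=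
    natDegree_map_eq_of_injective (Int.cast_injective) f
  -- Here G = x^dg + t, and G² - f itself is irreducible.
  obtain ⟨G, H, hG, hGd, hH, hHd, hGH⟩ := exists_irreducible_cofactor (N := FractionRing ℂ[X])
    (f := f.map (Int.castRingHom ℂ)) (A := 1) (T := 0) (m := dg) (hf.not_isSquare (hfd ▸ hf0))
    monic_one (by omega) (by simp; omega) (by simp; omega) (one_dvd _) isCoprime_one_left
  rw [Polynomial.map_map, RingHom.ext_int (RingHom.comp _ _) (Int.castRingHom (FractionRing ℂ[X])),
    Polynomial.map_one, one_mul] at hGH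
  simp only [natDegree_one, zero_add, add_zero] at hGd hHd
  obtain ⟨e, he, hτ⟩ := exists_bijOn_rootSet_family (M := AlgebraicClosure (FractionRing ℂ[X]))
    hd hG hGd hGH.symm hH.separable
  constructor
  · rw [← he.injOn.ncard_image, he.image_eq, ← hHd, Set.ncard_eq_toFinset_card',
      Set.toFinset_card, card_rootSet_eq_natDegree hH.separable (IsAlgClosed.splits _)]
  · intro x hx y hy
    obtain ⟨τ, h⟩ := hH.exists_algEquiv_apply_eq (mem_rootSet.1 (he.mapsTo hx)).2
      (mem_rootSet.1 (he.mapsTo hy)).2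
    obtain ⟨σ, hσ⟩ := hτ τ
    refine ⟨σ, he.injOn (apply_mem_rootSet σ hx) hy ((hσ x hx).trans h)⟩

theorem exists_algEquiv_family_apply_eq_of_apply_eq (hf : (f.map (Int.castRingHom ℂ)).Separable)
    (hf0 : f.natDegree ≠ 0) (hd : f.natDegree + 2 * dh < 2 * dg) (hdg : 2 ≤ dg) :
    ∃ x₀ ∈ (family f dg dh).rootSet (family f dg dh).SplittingField,
    ∀ x ∈ (family f dg dh).rootSet (family f dg dh).SplittingField,
    ∀ y ∈ (family f dg dh).rootSet (family f dg dh).SplittingField, x ≠ x₀ → y ≠ x₀ →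
      ∃ σ : (family f dg dh).SplittingField ≃ₐ[ParamField dg dh] (family f dg dh).SplittingField,
        σ x₀ = x₀ ∧ σ x = y := by
  have := charZero_fractionRing_polynomial
  have hfd : (f.map (Int.castRingHom ℂ)).natDegree = f.natDegree :=
    natDegree_map_eq_of_injective (Int.cast_injective) f
  obtain ⟨p, y, hy, hyp⟩ := exists_root_data hf
  -- Here G takes the value y at p, so p is a rational root, fixed by every automorphism; the
  -- conjugate roots of `H` are the others.
  obtain ⟨G, H, hG, hGd, hH, hHd, hGH⟩ := exists_irreducible_cofactor (N := FractionRing ℂ[X])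
    (f := f.map (Int.castRingHom ℂ)) (A := X - C p) (T := C y) (m := dg - 1)
    (hf.not_isSquare (hfd ▸ hf0)) (monic_X_sub_C p) (by omega) (by simp) (by simp; omega)
    (by rw [dvd_iff_isRoot]; simp [hyp])
    (isCoprime_C_right hy)
  rw [Polynomial.map_map, RingHom.ext_int (RingHom.comp _ _) (Int.castRingHom (FractionRing ℂ[X])),
    Polynomial.map_sub, map_X, map_C] at hGH
  simp only [natDegree_X_sub_C] at hGd hHd
  obtain ⟨p', hp'⟩ : ∃ p', p' = ((algebraMap ℂ[X] (FractionRing ℂ[X])).comp C) p := ⟨_, rfl⟩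
  rw [← hp'] at hGH
  -- The irreducible `H` has degree 2 `dg` - 1 ≥ 3.
  have hHp : ¬ H.IsRoot p' := hH.not_isRoot_of_natDegree_ne_one (by omega)
  have hsep : ((X - C p') * H).Separable := hH.separable_X_sub_C_mul hHp
  obtain ⟨e, he, hτ⟩ := exists_bijOn_rootSet_family (M := AlgebraicClosure (FractionRing ℂ[X]))
    hd hG (by omega) hGH.symm hsep
  have hmem (z) : z ∈ ((X - C p') * H).rootSet (AlgebraicClosure (FractionRing ℂ[X])) ↔
      z = algebraMap _ _ p' ∨ aeval z H = 0 := by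
    rw [mem_rootSet, and_iff_right hsep.ne_zero, map_mul, mul_eq_zero]
    simp [sub_eq_zero]
  obtain ⟨x₀, hx₀, hex₀⟩ := he.surjOn ((hmem _).2 (.inl rfl))
  refine ⟨x₀, hx₀, fun x hx y hy hxx hyx ↦ ?_⟩
  obtain ⟨τ, h⟩ := hH.exists_algEquiv_apply_eq
    (((hmem _).1 (he.mapsTo hx)).resolve_left fun h ↦ hxx (he.injOn hx hx₀ (h.trans hex₀.symm)))
    (((hmem _).1 (he.mapsTo hy)).resolve_left fun h ↦ hyx (he.injOn hy hx₀ (h.trans hex₀.symm)))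
  obtain ⟨σ, hσ⟩ := hτ τ
  refine ⟨σ, he.injOn (apply_mem_rootSet σ hx₀) hx₀ ((hσ x₀ hx₀).trans ?_),
    he.injOn (apply_mem_rootSet σ hx) hy ((hσ x hx).trans h)⟩
  rw [hex₀, τ.commutes]

theorem exists_algEquiv_family_swap_of_sq_dvd {k : Type*} [Field k] [CharZero k] [IsAlgClosed k]
    {g Q : k[X]} {p : k} (hd : f.natDegree + 2 * dh < 2 * dg) (hg : g.Monic)
    (hgd : g.natDegree = dg) (hQ : Q.Separable) (hQp : Q.eval p ≠ 0) (hgp : g.eval p ≠ 0)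
    (hgQ : g ^ 2 - f.map (Int.castRingHom k) = (X - C p) ^ 2 * Q) :
    ∃ v ∈ (family f dg dh).rootSet (family f dg dh).SplittingField,
    ∃ w ∈ (family f dg dh).rootSet (family f dg dh).SplittingField, v ≠ w ∧
      ∃ σ : (family f dg dh).SplittingField ≃ₐ[ParamField dg dh] (family f dg dh).SplittingField,
        σ v = w ∧ σ w = v ∧ ∀ x ∈ (family f dg dh).rootSet (family f dg dh).SplittingField,
          x ≠ v → x ≠ w → σ x = x := by
  let N := FractionRing (PowerSeries k)
  have : CharZero (PowerSeries k) :=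
    charZero_of_injective_algebraMap (R := k) PowerSeries.C_injective
  have : CharZero N :=
    charZero_of_injective_algebraMap (IsFractionRing.injective (PowerSeries k) N)
  obtain ⟨G, hG⟩ : ∃ G : N[X], G = g.map ((algebraMap (PowerSeries k) N).comp PowerSeries.C) +
    C (algebraMap (PowerSeries k) N PowerSeries.X) := ⟨_, rfl⟩
  have hGm : G.Monic := by
    rw [hG]
    refine (hg.map _).add_of_left (degree_C_le.trans_lt ?_)
    rw [hg.degree_map, ← natDegree_pos_iff_degree_pos]
    omega
  have hGd : G.natDegree = dg := by
    rw [hG, natDegree_add_C, hg.natDegree_map, hgd]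
  have hfdk : (f.map (Int.castRingHom k)).natDegree = f.natDegree :=
    natDegree_map_eq_of_injective (Int.cast_injective) f
  obtain ⟨P, hP⟩ : ∃ P, P = G ^ 2 - f.map (Int.castRingHom N) := ⟨_, rfl⟩
  obtain ⟨hns, S, hS, hcard⟩ := exists_finset_roots_sq_sub_of_sq_dvd (N := N) (P := P) hg
    (by omega) hQ (IsAlgClosed.splits _) hQp hgp hgQ (by
      rw [hP, hG, Polynomial.map_map (Int.castRingHom k),
        RingHom.ext_int (RingHom.comp _ (Int.castRingHom k)) (Int.castRingHom N)])
  have hP0 : P ≠ 0 := by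
    rintro rfl
    simp at hcard
  obtain ⟨hsep, v', hv', w', hw', hvw, τ, hτv, hτw, hτ⟩ :=
    separable_and_exists_swap_of_card_roots_add_two (M := AlgebraicClosure N) hP0 S hS hcard hns
  obtain ⟨e, he, hlift⟩ := exists_bijOn_rootSet_family (M := AlgebraicClosure N)
    hd hGm hGd hP hsep
  obtain ⟨v, hv, rfl⟩ := he.surjOn hv'
  obtain ⟨w, hw, rfl⟩ := he.surjOn hw'
  obtain ⟨σ, hσ⟩ := hlift τ
  refine ⟨v, hv, w, hw, fun h ↦ hvw (h ▸ rfl), σ,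
    he.injOn (apply_mem_rootSet σ hv) hw ((hσ v hv).trans hτv),
    he.injOn (apply_mem_rootSet σ hw) hv ((hσ w hw).trans hτw), fun x hx hxv hxw ↦
    he.injOn (apply_mem_rootSet σ hx) hx ((hσ x hx).trans ?_)⟩
  exact hτ _ (he.mapsTo hx) (fun h ↦ hxv (he.injOn hx hv h)) (fun h ↦ hxw (he.injOn hx hw h))

theorem exists_algEquiv_family_swap (hf : (f.map (Int.castRingHom ℂ)).Separable)
    (hf0 : f.natDegree ≠ 0) (hd : f.natDegree + 2 * dh < 2 * dg) (hdg : 3 ≤ dg) :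
    ∃ v ∈ (family f dg dh).rootSet (family f dg dh).SplittingField,
    ∃ w ∈ (family f dg dh).rootSet (family f dg dh).SplittingField, v ≠ w ∧
      ∃ σ : (family f dg dh).SplittingField ≃ₐ[ParamField dg dh] (family f dg dh).SplittingField,
        σ v = w ∧ σ w = v ∧ ∀ x ∈ (family f dg dh).rootSet (family f dg dh).SplittingField,
          x ≠ v → x ≠ w → σ x = x := by
  have := charZero_fractionRing_polynomial
  have hfd : (f.map (Int.castRingHom ℂ)).natDegree = f.natDegree :=
    natDegree_map_eq_of_injective (Int.cast_injective) f
  obtain ⟨p, y, hy, hyp⟩ := exists_root_data hf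
  -- y + c(x - p) is the first-order expansion of √f at p, so its square minus f has a double zero
  -- there.
  obtain ⟨c, hc⟩ : ∃ c : ℂ, 2 * y * c = (f.map (Int.castRingHom ℂ)).derivative.eval p :=
    ⟨_, mul_div_cancel₀ _ (mul_ne_zero two_ne_zero hy)⟩
  have hT : (C y + C c * (X - C p)).natDegree ≤ 1 := by compute_degree
  obtain ⟨G, H, hG, hGd, hH, hHd, hGH⟩ := exists_irreducible_cofactor (N := FractionRing ℂ[X])
    (f := f.map (Int.castRingHom ℂ)) (A := (X - C p) ^ 2) (T := C y + C c * (X - C p))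
    (m := dg - 2) (hf.not_isSquare (hfd ▸ hf0)) ((monic_X_sub_C p).pow 2) (by omega)
    (by rw [natDegree_pow, natDegree_X_sub_C]; omega)
    (by rw [natDegree_pow, natDegree_X_sub_C]; omega)
    (X_sub_C_sq_dvd (by simp [hyp]) (by simpa [derivative_pow, sub_eq_zero] using hc))
    (IsCoprime.pow_left (IsCoprime.add_mul_right_right
      (isCoprime_C_right hy) _))
  rw [Polynomial.map_map, RingHom.ext_int (RingHom.comp _ _) (Int.castRingHom (FractionRing ℂ[X])),
    Polynomial.map_pow, Polynomial.map_sub, map_X, map_C] at hGH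
  simp only [natDegree_pow, natDegree_X_sub_C] at hGd hHd
  set p' := ((algebraMap ℂ[X] (FractionRing ℂ[X])).comp C) p with hp'
  -- Over an algebraic closure `H` splits, so Hensel's lemma can lift all its roots.
  let k := AlgebraicClosure (FractionRing ℂ[X])
  have : CharZero k :=
    charZero_of_injective_algebraMap (algebraMap (FractionRing ℂ[X]) k).injective
  let ι := algebraMap (FractionRing ℂ[X]) k
  have hGH' : (G.map ι) ^ 2 - f.map (Int.castRingHom k) = (X - C (ι p')) ^ 2 * H.map ι := by
    have := congrArg (Polynomial.map ι) hGH
    simpa [Polynomial.map_map, RingHom.ext_int (RingHom.comp _ _) (Int.castRingHom k)] using this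
  have hfp : (f.map (Int.castRingHom k)).eval (ι p') ≠ 0 := by
    have h1 : f.map (Int.castRingHom k) = (f.map (Int.castRingHom ℂ)).map
        (ι.comp ((algebraMap ℂ[X] (FractionRing ℂ[X])).comp C)) := by
      rw [Polynomial.map_map, RingHom.ext_int (RingHom.comp _ _) (Int.castRingHom k)]
    rw [h1, hp', ← RingHom.comp_apply ι, eval_map, eval₂_at_apply, ← hyp]
    exact (_root_.map_ne_zero _).2 (pow_ne_zero 2 hy)
  -- At p the right side of `hGH'` vanishes, so G(p)² = f(p) ≠ 0.
  have hGp : (G.map ι).eval (ι p') ≠ 0 := by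
    intro h
    have := congrArg (eval (ι p')) hGH'
    simp only [eval_sub, eval_pow, h, eval_mul, eval_X, eval_C] at this
    apply hfp
    linear_combination -this
  have hHp : (H.map ι).eval (ι p') ≠ 0 := by
    rw [eval_map, eval₂_at_apply]
    exact (_root_.map_ne_zero _).2 (hH.not_isRoot_of_natDegree_ne_one (by omega))
  exact exists_algEquiv_family_swap_of_sq_dvd hd (hG.map ι) (by rw [hG.natDegree_map]; omega)
    hH.separable.map hHp hGp hGH'

end

end HyperellipticFamily

theorem proposition3p3 (f : ℤ[X]) (d n dg dh : ℕ)
    (hf : Squarefree (f.map (Int.castRingHom ℚ)))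
    (hfd : f.natDegree = d) (hd : Even d) (hd4 : 4 ≤ d)
    (hn : Even n) (hnd : d + 2 ≤ n)
    (hdg : dg = n / 2) (hdh : dh = (n - d) / 2 - 1) :
    (HyperellipticFamily.family f dg dh).natDegree = n ∧
      Irreducible (HyperellipticFamily.family f dg dh) ∧
      Nonempty ((HyperellipticFamily.family f dg dh).Gal ≃* Equiv.Perm (Fin n)) := by
  obtain ⟨d, rfl⟩ := hd
  obtain ⟨n, rfl⟩ := hn
  have hlt : f.natDegree + 2 * dh < 2 * dg := by omega
  have hn2 : 2 * dg = n + n := by omega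
  have hsep : (f.map (Int.castRingHom ℂ)).Separable := by
    have := (PerfectField.separable_iff_squarefree.2 hf).map (f := algebraMap ℚ ℂ)
    rwa [Polynomial.map_map, RingHom.ext_int (RingHom.comp _ _) (Int.castRingHom ℂ)] at this
  obtain ⟨hcard, htrans⟩ :=
    HyperellipticFamily.exists_algEquiv_family_apply_eq hsep (by omega) hlt
  have hdeg := HyperellipticFamily.natDegree_family hlt
  refine ⟨hdeg.trans hn2, ?_, ?_⟩
  · exact irreducible_of_forall_exists_algEquiv (by omega) (hcard.trans hdeg.symm) htrans
  · exact Polynomial.Gal.nonempty_mulEquiv_perm (hcard.trans hn2) htrans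
      (HyperellipticFamily.exists_algEquiv_family_apply_eq_of_apply_eq hsep (by omega) hlt
        (by omega))
      -- Since d ≥ 4 forces n ≥ 6, `dg` is at least 3 and the exponent `dg - 2` is positive.
      (HyperellipticFamily.exists_algEquiv_family_swap hsep (by omega) hlt (by omega))
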